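/- Let $n\ge 0$, let $x=(x_1,\dots,x_n)$ and $a=(a_0,a_1,\dots)$ be indeterminates over $\mathbb{Q}$, and put $(y|a)^r=\prod_{i=0}^{r-1}(y+a_i)$. Let $W_n=S_n\ltimes\{\pm1\}^n$ act on rational functions in $x$ by permuting the $x_i$ and replacing some of them by their inverses. For a partition $\lambda=(\lambda_1\ge\dots\ge\lambda_n\ge0)$ let $m_k$ be the number of $i\in\{1,\dots,n\}$ with $\lambda_i=k$, let $$v^{(n)}_\lambda(t)=\prod_{j=1}^{m_0}\frac{1-t^{2j}}{1-t}\ \prod_{k\ge1}\prod_{j=1}^{m_k}\frac{1-t^j}{1-t},$$ and define the factorial symplectic Hall--Littlewood function $$\mathcal{P}^C_\lambda(x|a;t)=\frac1{v^{(n)}_\lambda(t)}\sum_{w\in W_n}w\left(\prod_{i=1}^n(x_i|a)^{\lambda_i}\prod_{i=1}^n\frac{1-tx_i^{-2}}{1-x_i^{-2}}\prod_{1\le i<j\le n}\frac{1-tx_i^{-1}x_j}{1-x_i^{-1}x_j}\cdot\frac{1-tx_i^{-1}x_j^{-1}}{1-x_i^{-1}x_j^{-1}}\right).$$ For a strict partition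 $\lambda$ (strictly decreasing positive parts) of length $l(\lambda)\le n$, padded by zeros, the factorial symplectic $Q$-function is $Q^C_\lambda(x|a)=2^{l(\lambda)}\mathcal{P}^C_\lambda(x|a;-1)$, where $\mathcal{P}^C_\lambda(x|a;t)$, as a rational function of $t$, is reduced to lowest terms before setting $t=-1$; for $l(\lambda)>n$ put $Q^C_\lambda(x|a)=0$. The symplectic $Q$-function $Q^C_\lambda(x)$ is the case in which all $a_i$ are $0$. **Lemma.** For every strict partition $\lambda$, $$Q^C_\lambda(x|a)=\sum_\mu d_{\lambda,\mu}\,Q^C_\mu(x),\qquad d_{\lambda,\mu}=\det\Big(e_{\lambda_i-\mu_j}(a_0,\dots,a_{\lambda_i-1})\Big)_{1\le i,j\le l(\lambda)},$$ where $\mu$ runs over all strict partitions with $l(\mu)=l(\lambda)$ and $\mu\subset\lambda$ (that is, $\mu_i\le\lambda_i$ for all $i$), and $e_d$ is the $d$-th elementary symmetric polynomial, with $e_0=1$ and $e_d=0$ for $d<0$. -/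

import Mathlib

namespace SymplecticQ

open Finset

noncomputable section

/-- The factorial monomial `(x|a)^r = (x + a_0) (x + a_1) ⋯ (x + a_{r-1})`. -/
def facPow {R : Type*} [CommRing R] (a : ℕ → R) (x : R) (r : ℕ) : R :=
  ∏ i ∈ range r, (x + a i)

/-- `e_d(a_0, …, a_{m-1})`, the elementary symmetric polynomial of degree `d ∈ ℤ`, with
`e_d = 0` for `d < 0` (and for `d > m`). -/
def elemSymm {R : Type*} [CommRing R] (a : ℕ → R) (m : ℕ) (d : ℤ) : R :=
  if 0 ≤ d then ((Multiset.range m).map a).esymm d.toNat else 0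

/-- The normalising factor `v_λ^{(n)}(t)` of type `C_n` for a partition
`λ = (λ_1 ≥ … ≥ λ_n ≥ 0)`, as an element of `F(t)` (the indeterminate `t` is `RatFunc.X`). With
`m_k` the number of indices `i ≤ n` such that `λ_i = k` it equals
`∏_{j=1}^{m_0} (1 - t^{2j})/(1 - t) · ∏_{k ≥ 1} ∏_{j=1}^{m_k} (1 - t^j)/(1 - t)`. -/
def vC (F : Type*) [Field F] {n : ℕ} (lam : Fin n → ℕ) : RatFunc F :=
  (∏ j ∈ Icc 1 (#{i | lam i = 0}), (1 - RatFunc.X ^ (2 * j)) / (1 - RatFunc.X)) *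
    ∏ k ∈ (univ.image lam).erase 0,
      ∏ j ∈ Icc 1 (#{i | lam i = k}), (1 - RatFunc.X ^ j) / (1 - RatFunc.X)

/-- The expression to which the Weyl group is applied in the factorial symplectic
Hall--Littlewood function, at the variables `y_1, …, y_n` and the parameter `t`:
`∏_i (y_i|a)^{λ_i} · ∏_i (1 - t y_i^{-2})/(1 - y_i^{-2})
  · ∏_{i<j} (1 - t y_i^{-1} y_j)/(1 - y_i^{-1} y_j)
            · (1 - t y_i^{-1} y_j^{-1})/(1 - y_i^{-1} y_j^{-1})`. -/
def hlSummand {F : Type*} [Field F] {n : ℕ} (a : ℕ → F) (t : F) (lam : Fin n → ℕ)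
    (y : Fin n → F) : F :=
  (∏ i, facPow a (y i) (lam i)) *
    (∏ i, (1 - t * (y i)⁻¹ ^ 2) / (1 - (y i)⁻¹ ^ 2)) *
    ∏ p : Fin n × Fin n with p.1 < p.2,
      (1 - t * (y p.1)⁻¹ * y p.2) / (1 - (y p.1)⁻¹ * y p.2) *
        ((1 - t * (y p.1)⁻¹ * (y p.2)⁻¹) / (1 - (y p.1)⁻¹ * (y p.2)⁻¹))

/-- The action of an element `w = (σ, ε)` of the Weyl group `W_n = S_n ⋉ {±1}^n` on the
variables: `x_i ↦ x_{σ(i)}^{ε_i}`. -/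
def weylSubst {F : Type*} [Field F] {n : ℕ} (w : Equiv.Perm (Fin n) × (Fin n → ℤˣ))
    (x : Fin n → F) : Fin n → F :=
  fun i => x (w.1 i) ^ ((w.2 i : ℤˣ) : ℤ)

/-- The factorial symplectic Hall--Littlewood function
`P^C_λ(x|a;t) = v_λ^{(n)}(t)^{-1} ∑_{w ∈ W_n} w(⋯)` in `x_1, …, x_n`, as an element of `F(t)`. The
partition `λ` of length at most `n` is given by its parts `λ_1 ≥ … ≥ λ_n ≥ 0`. -/
def facHL {F : Type*} [Field F] {n : ℕ} (x : Fin n → F) (a : ℕ → F) (lam : Fin n → ℕ) :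
    RatFunc F :=
  (vC F lam)⁻¹ * ∑ w : Equiv.Perm (Fin n) × (Fin n → ℤˣ),
    hlSummand (fun k => RatFunc.C (a k)) RatFunc.X lam
      (weylSubst w (fun i => RatFunc.C (x i)))

/-- `λ = (λ_1 > … > λ_l > 0)` is a strict partition of length `l`. -/
def IsStrictPartition {l : ℕ} (lam : Fin l → ℕ) : Prop :=
  StrictAnti lam ∧ ∀ i, 0 < lam i

/-- A sequence of length `l ≤ n`, padded by zeros to length `n`. -/
def pad (n : ℕ) {l : ℕ} (lam : Fin l → ℕ) (i : Fin n) : ℕ :=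
  if h : (i : ℕ) < l then lam ⟨i, h⟩ else 0

/-- The factorial symplectic `Q`-function `Q^C_λ(x_1, …, x_n|a) = 2^l P^C_λ(x|a;-1)` of a strict
partition `λ` of length `l`. `RatFunc.eval` evaluates a fraction in lowest terms, so this is
the specialisation `t = -1` of the reduced function, also where `v_λ^{(n)}(-1) = 0`.
If `l > n`, the function is zero. -/
def facQ {F : Type*} [Field F] {n l : ℕ} (x : Fin n → F) (a : ℕ → F) (lam : Fin l → ℕ) : F :=
  if l ≤ n then 2 ^ l * RatFunc.eval (RingHom.id F) (-1) (facHL x a (pad n lam)) else 0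

/-- The symplectic `Q`-function `Q^C_λ(x)`: all factorial parameters are zero, so that
the factorial monomial `(x_i|a)^{λ_i}` is `x_i^{λ_i}`. -/
def sympQ {F : Type*} [Field F] {n l : ℕ} (x : Fin n → F) (lam : Fin l → ℕ) : F :=
  facQ x (fun _ => 0) lam

/-- `d_{λ,μ} = det (e_{λ_i - μ_j}(a_0, …, a_{λ_i - 1}))_{1 ≤ i, j ≤ l}`. -/
def coeffD {R : Type*} [CommRing R] {l : ℕ} (a : ℕ → R) (lam mu : Fin l → ℕ) : R :=
  Matrix.det (Matrix.of fun i j => elemSymm a (lam i) ((lam i : ℤ) - (mu j : ℤ)))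

open Classical in
/-- The strict partitions `μ ⊂ λ` (that is, `μ_i ≤ λ_i` for all `i`) with `l(μ) = l(λ) = l`. -/
def strictSub {l : ℕ} (lam : Fin l → ℕ) : Finset (Fin l → ℕ) :=
  {mu ∈ Finset.Iic lam | IsStrictPartition mu}

/-- The field `ℚ(x_1, …, x_n, a_0, a_1, …)` of rational functions, which contains the Laurent
polynomials in the `x_i` with coefficients in `ℚ[a_0, a_1, …]`. -/
abbrev RatField (n : ℕ) : Type := FractionRing (MvPolynomial (Fin n ⊕ ℕ) ℚ)

/-- The indeterminates `x_1, …, x_n`. -/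
def xVar (n : ℕ) (i : Fin n) : RatField n :=
  algebraMap (MvPolynomial (Fin n ⊕ ℕ) ℚ) (RatField n) (MvPolynomial.X (Sum.inl i))

/-- The factorial parameters `a_0, a_1, …`, which are indeterminates. -/
def aVar (n : ℕ) (k : ℕ) : RatField n :=
  algebraMap (MvPolynomial (Fin n ⊕ ℕ) ℚ) (RatField n) (MvPolynomial.X (Sum.inr k))

end

end SymplecticQ

namespace SymplecticQ

open Finset

noncomputable section

/-! Symmetrising over the last n - l variables, whose exponents are zero, already produces
`v_λ^{(n)}(t)`: the root factors with a given first index are summed by Lagrange interpolation, one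
index at a time (`sum_prod_erase_eq`, `sum_headProd_succ`). After cancellation (`facQ_eq`) the
Q-function is, up to a constant, a W_n-sum of the factorial monomial times the root factors whose
first index is among the first l. This is polynomial in t, so t = -1 may be substituted.

At t = -1 these factors are antisymmetric in the first l variables, so the symmetrised monomial
`altSum` alternates in its exponents. It also vanishes when some exponent is zero, because summing
out one more index gives a factor 1 - t^{2k} = 0. Expanding factorial powers into ordinary powers
and sorting the exponent vectors then collects the signed coefficients into determinants
(`sum_eq_sum_coeffD`). -/

/-! ### An interpolation identity. -/

/-- The monic polynomial ∏ (X - t z_j) has leading coefficient 1; Lagrange interpolation at 0 and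
the z_i computes it as a sum over nodes. -/
theorem sum_prod_erase_eq {K ι : Type*} [Field K] [DecidableEq ι] (t : K) (ht : t ≠ 1)
    (s : Finset ι) (z : ι → K) (hz : ∀ i, z i ≠ 0) (hinj : Set.InjOn z s) :
    ∑ i ∈ s, ∏ j ∈ s.erase i, (1 - t * (z i)⁻¹ * z j) / (1 - (z i)⁻¹ * z j) =
      (1 - t ^ #s) / (1 - t) := by
  classical
  have ht' : 1 - t ≠ 0 := sub_ne_zero.2 ht.symm
  set P : Polynomial K := ∏ j ∈ s, (Polynomial.X - Polynomial.C (t * z j)) with hP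
  have hmonic : P.Monic := Polynomial.monic_prod_of_monic _ _ fun j _ => Polynomial.monic_X_sub_C _
  have hdeg : P.natDegree = #s := by
    rw [hP, Polynomial.natDegree_prod_of_monic _ _ fun j _ => Polynomial.monic_X_sub_C _]
    simp only [Polynomial.natDegree_X_sub_C, sum_const, smul_eq_mul, mul_one]
  -- The extra node 0 raises the node count to degree + 1. It contributes t^#s, while node z i
  -- contributes 1 - t times its summand.
  set v : Option ι → K := fun o => o.elim 0 z with hv
  have hvinj : Set.InjOn v (insertNone s : Finset (Option ι)) := by
    rintro (_ | i) hi (_ | j) hj h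
    · rfl
    · exact absurd h.symm (hz j)
    · exact absurd h (hz i)
    · exact congrArg some (hinj (by simpa using hi) (by simpa using hj) h)
  have hcard : #(insertNone s) = P.degree + 1 := by
    rw [Polynomial.degree_eq_natDegree hmonic.ne_zero, hdeg]; simp
  have key := Lagrange.leadingCoeff_eq_sum hvinj hcard
  rw [hmonic.leadingCoeff] at key
  have hsplit : ∀ f : Option ι → K,
      ∑ i ∈ insertNone s, f i = f none + ∑ i ∈ s, f (some i) := fun f => by
    simp
  rw [hsplit] at key
  have h0 : Polynomial.eval (v none) P / ∏ j ∈ (insertNone s).erase none, (v none - v j) =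
      t ^ #s := by
    have : (insertNone s).erase none = s.map Function.Embedding.some := by ext (_ | i) <;> simp
    rw [this, prod_map, hP, Polynomial.eval_prod, ← prod_div_distrib, ← prod_const]
    refine prod_congr rfl fun j _ => ?_
    have := hz j
    simp [hv, this]
  have h1 : ∀ i ∈ s, Polynomial.eval (v (some i)) P /
      ∏ j ∈ (insertNone s).erase (some i), (v (some i) - v j) =
      (1 - t) * ∏ j ∈ s.erase i, (1 - t * (z i)⁻¹ * z j) / (1 - (z i)⁻¹ * z j) := by
    intro i hi
    have : (insertNone s).erase (some i) = insertNone (s.erase i) := by ext (_ | j) <;> simp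
    rw [this, hP, Polynomial.eval_prod, ← mul_prod_erase s _ hi, prod_insertNone]
    simp only [hv, Option.elim, Polynomial.eval_sub, Polynomial.eval_X, Polynomial.eval_C, sub_zero]
    rw [mul_div_mul_comm, ← prod_div_distrib]
    congr 1
    · have := hz i
      field_simp
    · refine prod_congr rfl fun j hj => ?_
      have := hz i
      have : 1 - t * (z i)⁻¹ * z j = (z i - t * z j) / z i := by field_simp
      rw [this]
      have : 1 - (z i)⁻¹ * z j = (z i - z j) / z i := by field_simp
      rw [this, div_div_div_cancel_right₀ (hz i)]
  rw [h0, sum_congr rfl h1, ← mul_sum] at key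
  rw [eq_div_iff ht']
  linear_combination -key

/-! ### The Weyl group acting on generic points. -/

/-- The values `y_i^{±1}` are nonzero and pairwise distinct. -/
def IsGeneric {K : Type*} [Field K] {n : ℕ} (y : Fin n → K) : Prop :=
  (∀ i, y i ≠ 0) ∧
    Function.Injective fun p : Fin n × ℤˣ => y p.1 ^ ((p.2 : ℤˣ) : ℤ)

theorem weylSubst_weylSubst {K : Type*} [Field K] {n : ℕ}
    (g w : Equiv.Perm (Fin n) × (Fin n → ℤˣ)) (x : Fin n → K) :
    weylSubst g (weylSubst w x) =
      weylSubst (w.1 * g.1, fun i => w.2 (g.1 i) * g.2 i) x := by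
  funext i
  simp [weylSubst, zpow_mul]

theorem IsGeneric.weylSubst {K : Type*} [Field K] {n : ℕ} {x : Fin n → K} (hx : IsGeneric x)
    (w : Equiv.Perm (Fin n) × (Fin n → ℤˣ)) : IsGeneric (weylSubst w x) := by
  refine ⟨fun i => zpow_ne_zero _ (hx.1 _), ?_⟩
  rintro ⟨i, d⟩ ⟨j, e⟩ h
  have h' : x (w.1 i) ^ ((w.2 i * d : ℤˣ) : ℤ) = x (w.1 j) ^ ((w.2 j * e : ℤˣ) : ℤ) := by
    simpa [SymplecticQ.weylSubst, zpow_mul] using h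
  have h2 := @hx.2 (w.1 i, w.2 i * d) (w.1 j, w.2 j * e) h'
  obtain ⟨h3, h4⟩ := Prod.mk.inj h2
  obtain rfl := w.1.injective h3
  rw [mul_left_cancel h4]

theorem sum_weylSubst_comp {K M : Type*} [Field K] [AddCommMonoid M] {n : ℕ}
    (g : Equiv.Perm (Fin n) × (Fin n → ℤˣ)) (x : Fin n → K) (f : (Fin n → K) → M) :
    ∑ w, f (weylSubst g (weylSubst w x)) = ∑ w, f (weylSubst w x) := by
  refine Fintype.sum_bijective
    (fun w : Equiv.Perm (Fin n) × (Fin n → ℤˣ) => (w.1 * g.1, fun i => w.2 (g.1 i) * g.2 i))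
    (Finite.injective_iff_bijective.1 ?_) _ _ fun w => by rw [weylSubst_weylSubst]
  rintro ⟨s, d⟩ ⟨s', d'⟩ h
  obtain ⟨h1, h2⟩ := Prod.mk.inj h
  obtain rfl := mul_right_cancel h1
  refine Prod.ext rfl (funext fun i => ?_)
  simpa using congrFun h2 (g.1.symm i)

/-! ### Root factors and partial symmetrisation. -/

/-- The factor of the long root attached to `u`. -/
def ownFactor {K : Type*} [Field K] (t u : K) : K :=
  (1 - t * u⁻¹ ^ 2) / (1 - u⁻¹ ^ 2)

/-- The factor of the two short roots attached to `u` and `v`. -/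
def pairFactor {K : Type*} [Field K] (t u v : K) : K :=
  (1 - t * u⁻¹ * v) / (1 - u⁻¹ * v) * ((1 - t * u⁻¹ * v⁻¹) / (1 - u⁻¹ * v⁻¹))

/-- The factors of the positive roots whose first index is `i`. -/
def headFactor {K : Type*} [Field K] {n : ℕ} (t : K) (y : Fin n → K) (i : Fin n) : K :=
  ownFactor t (y i) * ∏ j ∈ Ioi i, pairFactor t (y i) (y j)

/-- The factors of the positive roots whose first index is less than `l`. -/
def headProd {K : Type*} [Field K] {n : ℕ} (t : K) (l : ℕ) (y : Fin n → K) : K :=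
  ∏ i with (i : Fin n).val < l, headFactor t y i

theorem pairFactor_zpow {K : Type*} [Field K] (t u v : K) (e : ℤˣ) :
    pairFactor t u (v ^ (e : ℤ)) = pairFactor t u v := by
  rcases Int.units_eq_one_or e with rfl | rfl
  · simp
  · simp [pairFactor, mul_comm]

theorem pairFactor_eq_prod {K : Type*} [Field K] (t u v : K) :
    pairFactor t u v =
      ∏ e : ℤˣ, (1 - t * u⁻¹ * v ^ (e : ℤ)) / (1 - u⁻¹ * v ^ (e : ℤ)) := by
  have : (univ : Finset ℤˣ) = {1, -1} := rfl
  rw [this, prod_pair (by decide)]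
  simp [pairFactor]

/-- The Weyl group element sending the `m`-th variable to `x_k^e` and fixing all variables other
than the `m`-th and the `k`-th. -/
def moveTo {n : ℕ} (m : Fin n) (p : Fin n × ℤˣ) : Equiv.Perm (Fin n) × (Fin n → ℤˣ) :=
  (Equiv.swap m p.1, fun i => if i = m then p.2 else 1)

theorem weylSubst_moveTo_self {K : Type*} [Field K] {n : ℕ} (m : Fin n) (p : Fin n × ℤˣ)
    (y : Fin n → K) : weylSubst (moveTo m p) y m = y p.1 ^ (p.2 : ℤ) := by
  simp [weylSubst, moveTo]

theorem weylSubst_moveTo_of_ne {K : Type*} [Field K] {n : ℕ} {m : Fin n} (p : Fin n × ℤˣ)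
    (y : Fin n → K) {i : Fin n} (hi : i ≠ m) :
    weylSubst (moveTo m p) y i = y (Equiv.swap m p.1 i) := by
  simp [weylSubst, moveTo, hi]

theorem weylSubst_moveTo_of_lt {K : Type*} [Field K] {n : ℕ} {m : Fin n} {p : Fin n × ℤˣ}
    (hp : m ≤ p.1) (y : Fin n → K) {i : Fin n} (hi : i < m) :
    weylSubst (moveTo m p) y i = y i := by
  rw [weylSubst_moveTo_of_ne p y hi.ne, Equiv.swap_apply_of_ne_of_ne hi.ne (hi.trans_le hp).ne]

theorem swap_mem_iff_of_le {n : ℕ} {i m k : Fin n} (hm : i < m) (hk : m ≤ k) (j : Fin n) :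
    i < Equiv.swap m k j ↔ i < j := by
  rw [Equiv.swap_apply_def]
  split_ifs with h1 h2
  · subst h1; exact ⟨fun _ => hm, fun _ => hm.trans_le hk⟩
  · subst h2; exact ⟨fun _ => hm.trans_le hk, fun _ => hm⟩
  · rfl

/-- The product over j > i is unchanged when the later variables are permuted or inverted. -/
theorem headFactor_moveTo_of_lt {K : Type*} [Field K] {n : ℕ} (t : K) {m : Fin n}
    {p : Fin n × ℤˣ} (hp : m ≤ p.1) (y : Fin n → K) {i : Fin n} (hi : i < m) :
    headFactor t (weylSubst (moveTo m p) y) i = headFactor t y i := by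
  rw [headFactor, headFactor, weylSubst_moveTo_of_lt hp y hi]
  congr 1
  refine prod_equiv (Equiv.swap m p.1) (fun j => ?_) fun j _ => ?_
  · rw [mem_Ioi, mem_Ioi, swap_mem_iff_of_le hi hp]
  · simp only [weylSubst, pairFactor_zpow, moveTo]

theorem headProd_moveTo {K : Type*} [Field K] {n : ℕ} (t : K) {m : Fin n}
    {p : Fin n × ℤˣ} (hp : m ≤ p.1) (y : Fin n → K) :
    headProd t m (weylSubst (moveTo m p) y) = headProd t m y :=
  prod_congr rfl fun i hi => headFactor_moveTo_of_lt t hp y (by simpa using hi)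

/-- Puts the root factors in the shape of `sum_prod_erase_eq`, the nodes being the later variables
and their inverses. -/
theorem headFactor_moveTo_self {K : Type*} [Field K] {n : ℕ} (t : K) {m : Fin n}
    {p : Fin n × ℤˣ} (hp : m ≤ p.1) (y : Fin n → K) :
    headFactor t (weylSubst (moveTo m p) y) m =
      ∏ q ∈ (Ici m ×ˢ (univ : Finset ℤˣ)).erase p,
        (1 - t * (y p.1 ^ (p.2 : ℤ))⁻¹ * y q.1 ^ (q.2 : ℤ)) /
          (1 - (y p.1 ^ (p.2 : ℤ))⁻¹ * y q.1 ^ (q.2 : ℤ)) := by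
  obtain ⟨k, e⟩ := p
  -- The node inverse to the chosen one gives the long root; the other nodes pair up into the short
  -- roots.
  have hset : (Ici m ×ˢ (univ : Finset ℤˣ)).erase (k, e) =
      insert (k, -e) ((Ici m).erase k ×ˢ (univ : Finset ℤˣ)) := by
    ext ⟨j, d⟩
    have : d = e ∨ d = -e := by
      clear hp; decide +revert
    have hne : e ≠ -e := by clear this hp; decide +revert
    have hk : m ≤ k := hp
    simp only [mem_erase, mem_product, mem_Ici, mem_univ, and_true, mem_insert, Prod.mk.injEq, ne_eq]
    by_cases hjk : j = k
    · subst hjk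
      rcases this with rfl | rfl
      · simp [hne]
      · simp [hne.symm, hk]
    · simp [hjk]
  rw [hset, prod_insert (by simp), headFactor, weylSubst_moveTo_self]
  congr 1
  · simp only [ownFactor, Units.val_neg, zpow_neg]
    rw [sq, mul_assoc]
  · rw [prod_product]
    simp only [← pairFactor_eq_prod]
    refine prod_equiv (Equiv.swap m k) (fun j => ?_) fun j hj => ?_
    · have hk : m ≤ k := hp
      rw [mem_Ioi, mem_erase, mem_Ici, Equiv.swap_apply_def]
      split_ifs with h1 h2
      · subst h1; simp
      · subst h2
        exact ⟨fun h => ⟨h.ne, le_rfl⟩, fun h => lt_of_le_of_ne hk h.1⟩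
      · exact ⟨fun h => ⟨h2, h.le⟩, fun h => lt_of_le_of_ne h.2 (Ne.symm h1)⟩
    · rw [weylSubst_moveTo_of_ne _ _ (mem_Ioi.1 hj).ne']

theorem sum_moveTo_headFactor {K : Type*} [Field K] {n : ℕ} {t : K} (ht : t ≠ 1) (m : Fin n)
    {y : Fin n → K} (hy : IsGeneric y) :
    ∑ p ∈ Ici m ×ˢ (univ : Finset ℤˣ), headFactor t (weylSubst (moveTo m p) y) m =
      (1 - t ^ (2 * (n - m))) / (1 - t) := by
  rw [sum_congr rfl fun p hp => headFactor_moveTo_self t (mem_Ici.1 (mem_product.1 hp).1) y,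
    sum_prod_erase_eq t ht _ (fun q : Fin n × ℤˣ => y q.1 ^ (q.2 : ℤ))
      (fun q => zpow_ne_zero _ (hy.1 _)) hy.2.injOn, card_product, Fin.card_Ici]
  simp [mul_comm]

theorem headProd_succ {K : Type*} [Field K] {n : ℕ} (t : K) (m : Fin n) (y : Fin n → K) :
    headProd t (m + 1) y = headProd t m y * headFactor t y m := by
  have : ({i : Fin n | i.val < (m : ℕ) + 1} : Finset (Fin n)) =
      insert m ({i : Fin n | i.val < (m : ℕ)} : Finset (Fin n)) := by
    ext i
    simp only [mem_filter, mem_univ, true_and, mem_insert, Fin.ext_iff]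
    omega
  rw [headProd, this, prod_insert (by simp), mul_comm, headProd]

/-- Symmetrising over the variables from the `m`-th on removes the factors of the roots with first
index `m`. -/
theorem sum_headProd_succ {K : Type*} [Field K] {n : ℕ} {t : K} (ht : t ≠ 1) (m : Fin n)
    {x : Fin n → K} (hx : IsGeneric x) (f : (Fin n → K) → K)
    (hf : ∀ y z : Fin n → K, (∀ i < m, y i = z i) → f y = f z) :
    (2 * (n - m : ℕ) : K) * ∑ w, f (weylSubst w x) * headProd t (m + 1) (weylSubst w x) =
      (1 - t ^ (2 * (n - m))) / (1 - t) *
        ∑ w, f (weylSubst w x) * headProd t m (weylSubst w x) := by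
  set F : (Fin n → K) → K := fun y => f y * headProd t (m + 1) y with hF
  -- Each `moveTo m p` merely reindexes the W_n-sum, so summing over p costs the factor 2(n - m).
  -- For fixed w, only the factors with first index m depend on p.
  have h1 : ∑ p ∈ Ici m ×ˢ (univ : Finset ℤˣ), ∑ w, F (weylSubst (moveTo m p) (weylSubst w x)) =
      (2 * (n - m : ℕ) : K) * ∑ w, F (weylSubst w x) := by
    rw [sum_congr rfl fun p _ => sum_weylSubst_comp (moveTo m p) x F, sum_const, card_product,
      Fin.card_Ici, nsmul_eq_mul]
    simp [mul_comm]
  rw [← h1, sum_comm, mul_sum]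
  refine sum_congr rfl fun w _ => ?_
  rw [← sum_moveTo_headFactor ht m (hx.weylSubst w), mul_comm, mul_sum]
  refine sum_congr rfl fun p hp => ?_
  have hp' : m ≤ p.1 := mem_Ici.1 (mem_product.1 hp).1
  simp only [hF]
  rw [headProd_succ, headProd_moveTo t hp', hf _ _ fun i hi => weylSubst_moveTo_of_lt hp' _ hi,
    mul_assoc]

theorem sum_headProd_eq {K : Type*} [Field K] {n : ℕ} {t : K} (ht : t ≠ 1) {x : Fin n → K}
    (hx : IsGeneric x) (f : (Fin n → K) → K) {d : ℕ} (hd : d ≤ n)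
    (hf : ∀ y z : Fin n → K, (∀ i : Fin n, i.val < n - d → y i = z i) → f y = f z) :
    (∏ k ∈ range d, (2 * (k + 1 : ℕ) : K)) *
        ∑ w, f (weylSubst w x) * headProd t n (weylSubst w x) =
      (∏ k ∈ range d, (1 - t ^ (2 * (k + 1))) / (1 - t)) *
        ∑ w, f (weylSubst w x) * headProd t (n - d) (weylSubst w x) := by
  induction d with
  | zero => simp
  | succ d ih =>
    have h := sum_headProd_succ ht ⟨n - (d + 1), by omega⟩ hx f fun y z h => hf y z fun i hi => h i hi
    have h1 : n - (d + 1) + 1 = n - d := by omega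
    have h2 : n - (n - (d + 1)) = d + 1 := by omega
    simp only [h1, h2] at h
    have ih' := ih (by omega) fun y z h => hf y z fun i hi => h i (by omega)
    rw [prod_range_succ, prod_range_succ, mul_right_comm, ih', mul_right_comm, mul_assoc, h]
    ring

/-! ### Cancelling the normalising factor and setting t = -1. -/

theorem hlSummand_eq {F : Type*} [Field F] {n : ℕ} (a : ℕ → F) (t : F) (lam : Fin n → ℕ)
    (y : Fin n → F) :
    hlSummand a t lam y = (∏ i, facPow a (y i) (lam i)) * headProd t n y := by
  have h1 : ∀ i : Fin n, ({j | i < j} : Finset (Fin n)) = Ioi i := fun i => by ext; simp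
  simp only [hlSummand, headProd, Fin.is_lt, filter_true, headFactor, ownFactor, pairFactor,
    prod_mul_distrib, ← h1]
  simp only [prod_filter, Fintype.prod_prod_type, mul_assoc]

theorem facPow_map {R S : Type*} [CommRing R] [CommRing S] (g : R →+* S) (a : ℕ → R) (y : R)
    (r : ℕ) : facPow (fun k => g (a k)) (g y) r = g (facPow a y r) := by
  simp [facPow]

theorem weylSubst_map {K L : Type*} [Field K] [Field L] {n : ℕ} (g : K →+* L)
    (w : Equiv.Perm (Fin n) × (Fin n → ℤˣ)) (x : Fin n → K) :
    weylSubst w (fun i => g (x i)) = fun i => g (weylSubst w x i) := by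
  funext i
  simp [weylSubst, map_zpow₀]

theorem IsGeneric.map {K L : Type*} [Field K] [Field L] {n : ℕ} (g : K →+* L) {x : Fin n → K}
    (hx : IsGeneric x) : IsGeneric fun i => g (x i) := by
  refine ⟨fun i => (map_ne_zero g).2 (hx.1 i), fun p q h => hx.2 (g.injective ?_)⟩
  simpa [map_zpow₀] using h

/-- The fraction `r` is a polynomial whose value at `c` is `v`. -/
def SpecializesTo {F : Type*} [Field F] (c : F) (r : RatFunc F) (v : F) : Prop :=
  ∃ p : Polynomial F, algebraMap (Polynomial F) (RatFunc F) p = r ∧ p.eval c = v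

namespace SpecializesTo

variable {F : Type*} [Field F] {c : F}

theorem eval_eq {r : RatFunc F} {v : F} (h : SpecializesTo c r v) :
    RatFunc.eval (RingHom.id F) c r = v := by
  obtain ⟨p, rfl, rfl⟩ := h
  simp [Polynomial.eval₂_id]

theorem const (u : F) : SpecializesTo c (RatFunc.C u) u := ⟨Polynomial.C u, by simp, by simp⟩

theorem one : SpecializesTo c 1 1 := ⟨1, by simp, by simp⟩

theorem var : SpecializesTo c RatFunc.X c := ⟨Polynomial.X, by simp, by simp⟩

theorem sub {r s : RatFunc F} {u v : F} (hr : SpecializesTo c r u) (hs : SpecializesTo c s v) :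
    SpecializesTo c (r - s) (u - v) := by
  obtain ⟨p, rfl, rfl⟩ := hr
  obtain ⟨q, rfl, rfl⟩ := hs
  exact ⟨p - q, by simp, by simp⟩

theorem mul {r s : RatFunc F} {u v : F} (hr : SpecializesTo c r u) (hs : SpecializesTo c s v) :
    SpecializesTo c (r * s) (u * v) := by
  obtain ⟨p, rfl, rfl⟩ := hr
  obtain ⟨q, rfl, rfl⟩ := hs
  exact ⟨p * q, by simp, by simp⟩

theorem sum {ι : Type*} (s : Finset ι) {r : ι → RatFunc F} {v : ι → F}
    (h : ∀ i ∈ s, SpecializesTo c (r i) (v i)) :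
    SpecializesTo c (∑ i ∈ s, r i) (∑ i ∈ s, v i) := by
  choose! p hp using h
  exact ⟨∑ i ∈ s, p i, by rw [map_sum]; exact sum_congr rfl fun i hi => (hp i hi).1,
    by rw [Polynomial.eval_finsetSum]; exact sum_congr rfl fun i hi => (hp i hi).2⟩

theorem prod {ι : Type*} (s : Finset ι) {r : ι → RatFunc F} {v : ι → F}
    (h : ∀ i ∈ s, SpecializesTo c (r i) (v i)) :
    SpecializesTo c (∏ i ∈ s, r i) (∏ i ∈ s, v i) := by
  choose! p hp using h
  exact ⟨∏ i ∈ s, p i, by rw [map_prod]; exact prod_congr rfl fun i hi => (hp i hi).1,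
    by rw [Polynomial.eval_prod]; exact prod_congr rfl fun i hi => (hp i hi).2⟩

/-- The denominator does not involve t, so the fraction is a polynomial in t. -/
theorem rootFactor (u : F) :
    SpecializesTo c ((1 - RatFunc.X * RatFunc.C u) / (1 - RatFunc.C u)) ((1 - c * u) / (1 - u)) := by
  have : (1 - RatFunc.C u : RatFunc F)⁻¹ = RatFunc.C (1 - u)⁻¹ := by simp
  rw [div_eq_mul_inv, div_eq_mul_inv, this]
  exact (one.sub (var.mul (const u))).mul (const _)

theorem ownFactor (u : F) :
    SpecializesTo c (ownFactor RatFunc.X (RatFunc.C u)) (ownFactor c u) := by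
  have h := rootFactor (c := c) (u⁻¹ ^ 2)
  simpa [SymplecticQ.ownFactor] using h

theorem pairFactor (u v : F) :
    SpecializesTo c (pairFactor RatFunc.X (RatFunc.C u) (RatFunc.C v)) (pairFactor c u v) := by
  have h := (rootFactor (c := c) (u⁻¹ * v)).mul (rootFactor (c := c) (u⁻¹ * v⁻¹))
  simpa [SymplecticQ.pairFactor, mul_assoc] using h

theorem headProd {n : ℕ} (l : ℕ) (y : Fin n → F) :
    SpecializesTo c (headProd RatFunc.X l fun i => RatFunc.C (y i)) (headProd c l y) :=
  prod _ fun _ _ => (ownFactor _).mul (prod _ fun _ _ => pairFactor _ _)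

end SpecializesTo

/-- Positive parts of a strict partition have multiplicity one, so only the n - l zeros contribute.
-/
theorem vC_pad (F : Type*) [Field F] {n l : ℕ} (hl : l ≤ n) {lam : Fin l → ℕ}
    (hlam : IsStrictPartition lam) :
    vC F (pad n lam) =
      ∏ k ∈ range (n - l), (1 - RatFunc.X ^ (2 * (k + 1))) / (1 - RatFunc.X) := by
  have hX : (1 - RatFunc.X : RatFunc F) ≠ 0 := by
    intro h
    have := congrArg (RatFunc.eval (RingHom.id F) 0) (sub_eq_zero.1 h)
    simp at this
  have h0 : #{i | pad n lam i = 0} = n - l := by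
    have : ({i | pad n lam i = 0} : Finset (Fin n)) = ({i | i.val < l} : Finset (Fin n))ᶜ := by
      ext i
      simp only [mem_filter, mem_univ, true_and, mem_compl]
      rw [pad]
      split_ifs with h
      · simp [h, (hlam.2 ⟨i, h⟩).ne']
      · simp [h]
    rw [this, card_compl, Fintype.card_fin, Fin.card_filter_val_lt, min_eq_right hl]
  have h1 : ∀ k ∈ (univ.image (pad n lam)).erase 0,
      ∏ j ∈ Icc 1 (#{i | pad n lam i = k}), (1 - RatFunc.X ^ j : RatFunc F) / (1 - RatFunc.X) =
        1 := by
    intro k hk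
    have hk0 := ne_of_mem_erase hk
    have : #{i | pad n lam i = k} ≤ 1 := by
      rw [card_le_one]
      intro i hi j hj
      simp only [mem_filter, mem_univ, true_and] at hi hj
      rw [pad] at hi hj
      split_ifs at hi hj with h h'
      · simpa [Fin.ext_iff] using hlam.1.injective (hi.trans hj.symm)
      all_goals omega
    refine prod_eq_one fun j hj => ?_
    have : j = 1 := by have := mem_Icc.1 hj; omega
    rw [this, pow_one, div_self hX]
  rw [vC, h0, prod_eq_one h1, mul_one, range_eq_Ico, prod_Ico_add' (fun k =>
    (1 - RatFunc.X ^ (2 * k) : RatFunc F) / (1 - RatFunc.X)) 0 (n - l) 1]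
  rfl

theorem one_sub_X_pow_ne_zero (F : Type*) [Field F] {k : ℕ} (hk : k ≠ 0) :
    (1 - RatFunc.X ^ k : RatFunc F) ≠ 0 := by
  intro h
  have h' := (SpecializesTo.one (c := (0 : F))).sub
    (SpecializesTo.prod (range k) fun _ _ => SpecializesTo.var (c := (0 : F)))
  simp only [prod_const, card_range, h] at h'
  have := h'.eval_eq
  simp [hk] at this

/-- The closed form of the `Q`-function, in which the factor `v_λ^{(n)}(t)` has been cancelled. -/
theorem facQ_eq {F : Type*} [Field F] [CharZero F] {n l : ℕ} (hl : l ≤ n) {x : Fin n → F}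
    (hx : IsGeneric x) (a : ℕ → F) {lam : Fin l → ℕ} (hlam : IsStrictPartition lam) :
    facQ x a lam = 2 ^ l * ((∏ k ∈ range (n - l), (2 * (k + 1 : ℕ) : F))⁻¹ *
      ∑ w, (∏ i, facPow a (weylSubst w x i) (pad n lam i)) *
        headProd (-1) l (weylSubst w x)) := by
  rw [facQ, if_pos hl]
  congr 1
  have hX : (RatFunc.X : RatFunc F) ≠ 1 := fun h =>
    one_sub_X_pow_ne_zero F one_ne_zero (by rw [pow_one, h, sub_self])
  have key := sum_headProd_eq hX (hx.map RatFunc.C)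
    (fun y => ∏ i, facPow (fun k => RatFunc.C (a k)) (y i) (pad n lam i)) (Nat.sub_le n l) (by
      intro y z h
      refine prod_congr rfl fun i _ => ?_
      by_cases hi : i.val < l
      · rw [h i (by omega)]
      · simp [pad, hi, facPow])
  rw [Nat.sub_sub_self hl, ← vC_pad F hl hlam] at key
  have hv : vC F (pad n lam) ≠ 0 := by
    rw [vC_pad F hl hlam]
    exact prod_ne_zero_iff.2 fun k _ => div_ne_zero (one_sub_X_pow_ne_zero F (by omega))
      (sub_ne_zero.2 hX.symm)
  -- This is the order of the Weyl group of the last n - l variables.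
  set A : F := ∏ k ∈ range (n - l), (2 * (k + 1 : ℕ) : F) with hA
  have hA0 : A ≠ 0 := prod_ne_zero_iff.2 fun k _ =>
    mul_ne_zero two_ne_zero (Nat.cast_ne_zero.2 k.succ_ne_zero)
  have hAC : ∏ k ∈ range (n - l), (2 * (k + 1 : ℕ) : RatFunc F) = RatFunc.C A := by
    rw [hA, map_prod]
    simp only [map_mul, map_natCast, map_ofNat]
  rw [hAC] at key
  have h1 : facHL x a (pad n lam) = RatFunc.C A⁻¹ *
      ∑ w, (∏ i, facPow (fun k => RatFunc.C (a k))
        (weylSubst w (fun i => RatFunc.C (x i)) i) (pad n lam i)) *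
        headProd RatFunc.X l (weylSubst w (fun i => RatFunc.C (x i))) := by
    have hAC0 : (RatFunc.C A : RatFunc F) ≠ 0 := (map_ne_zero _).2 hA0
    rw [facHL, map_inv₀, inv_mul_eq_iff_eq_mul₀ hv, mul_left_comm, ← key,
      inv_mul_cancel_left₀ hAC0]
    simp only [hlSummand_eq]
  rw [h1]
  apply SpecializesTo.eval_eq
  refine (SpecializesTo.const _).mul (SpecializesTo.sum _ fun w _ => ?_)
  rw [weylSubst_map]
  refine (SpecializesTo.prod _ fun i _ => ?_).mul (SpecializesTo.headProd _ _)
  rw [facPow_map]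
  exact SpecializesTo.const _

/-! ### Expansion in monomials and the determinant. -/

theorem facPow_eq_sum {R : Type*} [CommRing R] (a : ℕ → R) (y : R) (r : ℕ) :
    facPow a y r = ∑ k ∈ Iic r, elemSymm a r ((r : ℤ) - (k : ℤ)) * y ^ k := by
  have h := congrArg (Polynomial.eval y)
    (Multiset.prod_X_add_C_eq_sum_esymm ((Multiset.range r).map a))
  have h1 : Polynomial.eval y ((((Multiset.range r).map a).map
      fun u => Polynomial.X + Polynomial.C u).prod) = facPow a y r := by
    rw [Multiset.map_map, ← Finset.range_val]
    change Polynomial.eval y (∏ i ∈ range r, (Polynomial.X + Polynomial.C (a i))) = _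
    simp [Polynomial.eval_prod, facPow]
  rw [h1] at h
  rw [h, Polynomial.eval_finsetSum, Multiset.card_map, Multiset.card_range,
    ← sum_range_reflect]
  have h2 : Iic r = range (r + 1) := by ext; simp
  rw [h2]
  refine sum_congr rfl fun k hk => ?_
  have hk : k ≤ r := Nat.lt_succ_iff.1 (mem_range.1 hk)
  have h4 : r - (r - k) = k := by omega
  have h5 : ((r : ℤ) - k).toNat = r - k := by omega
  simp [elemSymm, h4, h5, hk]

theorem prod_facPow_eq_sum {R : Type*} [CommRing R] {l : ℕ} (a : ℕ → R) (y : Fin l → R)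
    (lam : Fin l → ℕ) :
    ∏ i, facPow a (y i) (lam i) = ∑ al ∈ Iic lam,
      (∏ i, elemSymm a (lam i) ((lam i : ℤ) - (al i : ℤ))) * ∏ i, y i ^ al i := by
  simp only [facPow_eq_sum, ← prod_mul_distrib]
  rw [prod_univ_sum]
  refine sum_congr ?_ fun _ _ => rfl
  ext al
  simp [Fintype.mem_piFinset, Pi.le_def]

/-- An injective sequence below a decreasing sequence `λ` can be sorted into a decreasing sequence
that is still below `λ`. -/
theorem exists_strictAnti_comp_perm {l : ℕ} {lam al : Fin l → ℕ} (hlam : Antitone lam)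
    (hal : al ≤ lam) (hinj : Function.Injective al) :
    ∃ (mu : Fin l → ℕ) (s : Equiv.Perm (Fin l)), StrictAnti mu ∧ mu ≤ lam ∧ mu ∘ s = al := by
  set s : Equiv.Perm (Fin l) := Fin.revPerm.trans (Tuple.sort al) with hs
  have hanti : Antitone (al ∘ s) := fun i j hij =>
    Tuple.monotone_sort al (Fin.rev_le_rev.2 hij)
  refine ⟨al ∘ s, s⁻¹, hanti.strictAnti_of_injective (hinj.comp s.injective), fun i => ?_, ?_⟩
  -- Pigeonhole: the i + 1 indices up to i cannot all be sent below i.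
  · obtain ⟨j, hj, hij⟩ : ∃ j ≤ i, i ≤ s j := by
      by_contra! h
      have := card_le_card_of_injOn (s := Iic i) (t := Iio i) s
        (fun j hj => by simpa using h j (by simpa using hj)) s.injective.injOn
      simp at this
    exact (hanti hj).trans ((hal (s j)).trans (hlam hij))
  · funext i
    simp

/-- A strictly decreasing sequence is determined by its set of values. -/
theorem comp_perm_injective {l : ℕ} {mu nu : Fin l → ℕ} {s t : Equiv.Perm (Fin l)}
    (hmu : StrictAnti mu) (hnu : StrictAnti nu) (h : mu ∘ s = nu ∘ t) : mu = nu ∧ s = t := by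
  have hmn : mu = nu := by
    rw [← hmu.range_inj hnu, ← s.surjective.range_comp mu, h, t.surjective.range_comp]
  subst hmn
  exact ⟨rfl, Equiv.ext fun i => hmu.injective (congrFun h i)⟩

theorem sum_eq_sum_coeffD {R : Type*} [CommRing R] {l : ℕ} (a : ℕ → R) {lam : Fin l → ℕ}
    (hlam : IsStrictPartition lam) (D : (Fin l → ℕ) → R)
    (hperm : ∀ (al : Fin l → ℕ) (s : Equiv.Perm (Fin l)),
      D (al ∘ s) = (Equiv.Perm.sign s : ℤ) * D al)
    (hinj : ∀ al : Fin l → ℕ, ¬ Function.Injective al → D al = 0)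
    (hzero : ∀ al : Fin l → ℕ, (∃ i, al i = 0) → D al = 0) :
    ∑ al ∈ Iic lam, (∏ i, elemSymm a (lam i) ((lam i : ℤ) - (al i : ℤ))) * D al =
      ∑ mu ∈ strictSub lam, coeffD a lam mu * D mu := by
  classical
  have h1 : ∀ mu ∈ strictSub lam, coeffD a lam mu * D mu = ∑ s : Equiv.Perm (Fin l),
      (∏ i, elemSymm a (lam i) ((lam i : ℤ) - ((mu ∘ s) i : ℤ))) * D (mu ∘ s) := by
    intro mu _
    rw [coeffD, ← Matrix.det_transpose, Matrix.det_apply', sum_mul]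
    refine sum_congr rfl fun s _ => ?_
    rw [hperm]
    simp only [Matrix.transpose_apply, Matrix.of_apply, Function.comp_apply]
    ring
  rw [sum_congr rfl h1, ← sum_product']
  symm
  -- Only nonzero terms are matched: e_d = 0 for d < 0 forces mu ∘ s ≤ lam, and D vanishes on
  -- repeated or zero exponents.
  refine sum_bij_ne_zero (fun p _ _ => p.1 ∘ p.2) ?_ ?_ ?_ fun _ _ _ => rfl
  · intro p _ hp
    rw [mem_Iic]
    intro i
    by_contra hi
    refine hp ?_
    rw [prod_eq_zero (mem_univ i), zero_mul]
    have : ¬ (0 ≤ (lam i : ℤ) - ((p.1 ∘ p.2) i : ℤ)) := by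
      have : lam i < (p.1 ∘ p.2) i := not_le.1 hi
      omega
    rw [elemSymm, if_neg this]
  · intro p hp _ q hq _ h
    rw [mem_product, strictSub, mem_filter] at hp hq
    obtain ⟨h2, h3⟩ := comp_perm_injective hp.1.2.1 hq.1.2.1 h
    exact Prod.ext h2 h3
  · intro al hal hne
    have hD : D al ≠ 0 := right_ne_zero_of_mul hne
    obtain ⟨mu, s, hmu, hle, rfl⟩ := exists_strictAnti_comp_perm hlam.1.antitone (mem_Iic.1 hal)
      (not_not.1 fun h => hD (hinj al h))
    refine ⟨(mu, s), ?_, hne, rfl⟩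
    rw [mem_product, strictSub, mem_filter, mem_Iic]
    refine ⟨⟨hle, hmu, fun i => Nat.pos_of_ne_zero fun h => hD (hzero _ ⟨s.symm i, by simpa⟩)⟩,
      mem_univ _⟩

/-! ### Antisymmetry and vanishing at t = -1. -/

/-- At t = -1 the first fraction becomes (u + v)/(u - v), which is antisymmetric; the second is
symmetric. -/
theorem pairFactor_neg_one_swap {K : Type*} [Field K] {u v : K} (hu : u ≠ 0) (hv : v ≠ 0) :
    pairFactor (-1) u v = -pairFactor (-1) v u := by
  have h : ∀ {u v : K}, u ≠ 0 → pairFactor (-1) u v =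
      (u + v) / (u - v) * ((1 + u⁻¹ * v⁻¹) / (1 - u⁻¹ * v⁻¹)) := by
    intro u v hu
    have h1 : 1 - -1 * u⁻¹ * v = (u + v) / u := by field_simp; ring
    have h2 : 1 - u⁻¹ * v = (u - v) / u := by field_simp
    rw [pairFactor, h1, h2, div_div_div_cancel_right₀ hu]
    ring
  rw [h hu, h hv, ← neg_sub u v, div_neg, add_comm v u, mul_comm v⁻¹]
  ring

/-- At `t = -1` the factors with first index less than `l` are antisymmetric in the first `l`
variables. -/
theorem headProd_neg_one_comp_perm {K : Type*} [Field K] {n l : ℕ} {y : Fin n → K}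
    (hy : ∀ i, y i ≠ 0) {s : Equiv.Perm (Fin n)} (hs : ∀ i, l ≤ (i : Fin n).val → s i = i) :
    headProd (-1) l (y ∘ s) = (Equiv.Perm.sign s : ℤ) * headProd (-1) l y := by
  have hs' : ∀ i, (s i).val < l ↔ i.val < l := by
    intro i
    constructor
    · intro h
      by_contra h'
      rw [hs i (not_lt.1 h')] at h
      exact h' h
    · intro h
      by_contra h'
      rw [s.injective (hs _ (not_lt.1 h'))] at h'
      exact h' h
  -- An antisymmetric extension to all pairs, so that the sign rule for products over i < j applies.
  -- Beyond l it is a sign of the index order, harmless because s fixes those indices.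
  set f : (Fin n → K) → Fin n → Fin n → K := fun y i j =>
    if i.val < l then pairFactor (-1) (y i) (y j)
    else if j.val < l then -pairFactor (-1) (y j) (y i)
    else if i < j then 1 else if j < i then -1 else 0 with hf
  have hanti : ∀ i j, f y i j = -f y j i := by
    intro i j
    simp only [hf]
    by_cases hi : i.val < l <;> by_cases hj : j.val < l
    · simp only [hi, hj, if_true]
      exact pairFactor_neg_one_swap (hy i) (hy j)
    · simp [hi, hj]
    · simp [hi, hj]
    · rcases lt_trichotomy i j with h | h | h
      · simp [hi, hj, h, h.not_gt]
      · subst h; simp [hi]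
      · simp [hi, hj, h, h.not_gt]
  have hcomp : ∀ i j, f y (s i) (s j) = f (y ∘ s) i j := by
    intro i j
    simp only [hf, hs', Function.comp_apply]
    by_cases hi : i.val < l <;> by_cases hj : j.val < l
    · simp [hi]
    · simp [hi]
    · simp [hi, hj]
    · simp [hi, hj, hs i (not_lt.1 hi), hs j (not_lt.1 hj)]
  have hprod : ∀ y : Fin n → K, headProd (-1) l y =
      (∏ i with (i : Fin n).val < l, ownFactor (-1) (y i)) * ∏ i, ∏ j ∈ Ioi i, f y i j := by
    intro y
    simp only [headProd, headFactor, prod_mul_distrib]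
    congr 1
    rw [prod_filter]
    refine prod_congr rfl fun i _ => ?_
    split_ifs with hi
    · simp [hf, hi]
    · refine (prod_eq_one fun j hj => ?_).symm
      have hij := mem_Ioi.1 hj
      have hj : ¬ j.val < l := fun h => hi (lt_trans hij h)
      simp [hf, hi, hj, hij]
  rw [hprod, hprod]
  simp only [← hcomp]
  rw [Equiv.Perm.prod_Ioi_comp_eq_sign_mul_prod s hanti, mul_left_comm]
  congr 2
  exact prod_equiv s (fun i => by simp [hs']) fun i _ => rfl

/-- The symmetrisation of a monomial in the first `l` variables at `t = -1`. -/
def altSum {K : Type*} [Field K] {n l : ℕ} (hl : l ≤ n) (x : Fin n → K) (al : Fin l → ℕ) : K :=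
  ∑ w, (∏ i, weylSubst w x (Fin.castLE hl i) ^ al i) * headProd (-1) l (weylSubst w x)

theorem altSum_comp_perm {K : Type*} [Field K] {n l : ℕ} (hl : l ≤ n) {x : Fin n → K}
    (hx : IsGeneric x) (al : Fin l → ℕ) (s : Equiv.Perm (Fin l)) :
    altSum hl x (al ∘ s) = (Equiv.Perm.sign s : ℤ) * altSum hl x al := by
  set e : Fin l ↪ Fin n := Fin.castLEEmb hl
  set r : Equiv.Perm (Fin n) := s⁻¹.viaFintypeEmbedding e with hr
  have hre : ∀ i, r (Fin.castLE hl i) = Fin.castLE hl (s⁻¹ i) := fun i =>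
    Equiv.Perm.viaFintypeEmbedding_apply_image s⁻¹ e i
  have hrfix : ∀ i : Fin n, l ≤ i.val → r i = i := fun i hi =>
    Equiv.Perm.viaFintypeEmbedding_apply_notMem_range s⁻¹ e (by
      rintro ⟨j, rfl⟩
      exact absurd j.is_lt (not_lt.2 hi))
  have hsign : Equiv.Perm.sign r = Equiv.Perm.sign s := by
    rw [hr, Equiv.Perm.viaFintypeEmbedding_sign, Equiv.Perm.sign_inv]
  have hsub : ∀ y : Fin n → K, weylSubst (r, 1) y = y ∘ r := fun y => by
    funext i; simp [weylSubst]
  rw [altSum, altSum, ← sum_weylSubst_comp (r, 1) x fun y =>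
    (∏ i, y (Fin.castLE hl i) ^ al i) * headProd (-1) l y, mul_sum]
  refine sum_congr rfl fun w _ => ?_
  rw [hsub, headProd_neg_one_comp_perm (hx.weylSubst w).1 hrfix, hsign]
  have h1 : ∏ i, (weylSubst w x ∘ r) (Fin.castLE hl i) ^ al i =
      ∏ i, weylSubst w x (Fin.castLE hl i) ^ (al ∘ s) i := by
    refine Fintype.prod_equiv s⁻¹ _ _ fun i => ?_
    simp [hre]
  have h2 : ((Equiv.Perm.sign s : ℤ) : K) * ((Equiv.Perm.sign s : ℤ) : K) = 1 := by
    rw [← Int.cast_mul, ← Units.val_mul, Int.units_mul_self]; simp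
  rw [h1]
  linear_combination (-(∏ i, weylSubst w x (Fin.castLE hl i) ^ (al ∘ s) i) *
    headProd (-1) l (weylSubst w x)) * h2

theorem altSum_eq_zero_of_not_injective {K : Type*} [Field K] [CharZero K] {n l : ℕ} (hl : l ≤ n)
    {x : Fin n → K} (hx : IsGeneric x) {al : Fin l → ℕ} (hal : ¬ Function.Injective al) :
    altSum hl x al = 0 := by
  simp only [Function.Injective, not_forall] at hal
  obtain ⟨i, j, hij, hne⟩ := hal
  have h := altSum_comp_perm hl hx al (Equiv.swap i j)
  have h1 : al ∘ Equiv.swap i j = al := by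
    funext k
    simp only [Function.comp_apply, Equiv.swap_apply_def]
    split_ifs with h h' <;> simp_all
  rw [h1, Equiv.Perm.sign_swap hne] at h
  simpa [eq_neg_iff_add_eq_zero, ← two_mul] using h

theorem altSum_eq_zero_of_last {K : Type*} [Field K] [CharZero K] {n l : ℕ} (hl : l + 1 ≤ n)
    {x : Fin n → K} (hx : IsGeneric x) {al : Fin (l + 1) → ℕ} (hal : al (Fin.last l) = 0) :
    altSum hl x al = 0 := by
  -- With last exponent zero the monomial ignores that variable, so its root factors sum to a
  -- multiple of 1 - t^{2(n-l)}, zero at t = -1.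
  have h := sum_headProd_succ (t := (-1 : K)) (by norm_num) ⟨l, hl⟩ hx
    (fun y => ∏ i, y (Fin.castLE hl i) ^ al i) (by
      intro y z h
      simp only [Fin.prod_univ_castSucc, hal, pow_zero]
      congr 1
      exact prod_congr rfl fun i _ => by rw [h _ i.is_lt])
  rw [pow_mul, neg_one_sq, one_pow, sub_self, zero_div, zero_mul] at h
  refine (mul_eq_zero.1 h).resolve_left (mul_ne_zero two_ne_zero (Nat.cast_ne_zero.2 ?_))
  simp only
  omega

theorem altSum_eq_zero_of_zero {K : Type*} [Field K] [CharZero K] {n l : ℕ} (hl : l ≤ n)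
    {x : Fin n → K} (hx : IsGeneric x) {al : Fin l → ℕ} (hal : ∃ i, al i = 0) :
    altSum hl x al = 0 := by
  obtain ⟨i, hi⟩ := hal
  obtain _ | l := l
  · exact i.elim0
  -- Up to sign, the zero exponent may be moved to the last position.
  · have h := altSum_comp_perm hl hx al (Equiv.swap i (Fin.last l))
    rw [altSum_eq_zero_of_last hl hx (by simpa using hi)] at h
    refine (mul_eq_zero.1 h.symm).resolve_left ?_
    simp

/-! ### Assembly, and genericity of the indeterminates. -/

theorem prod_pad {R : Type*} [CommRing R] {n l : ℕ} (hl : l ≤ n) (a : ℕ → R) (y : Fin n → R)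
    (lam : Fin l → ℕ) :
    ∏ i, facPow a (y i) (pad n lam i) = ∏ i, facPow a (y (Fin.castLE hl i)) (lam i) := by
  symm
  refine Fintype.prod_of_injective (Fin.castLE hl) (Fin.castLE_injective hl) _ _ ?_ ?_
  · intro i hi
    have : ¬ i.val < l := fun h => hi ⟨⟨i, h⟩, rfl⟩
    simp [pad, this, facPow]
  · intro i
    simp [pad]

/-- The expansion holds over any field of characteristic zero, for generic variables. -/
theorem facQ_eq_sum_coeffD {F : Type*} [Field F] [CharZero F] {n l : ℕ} {x : Fin n → F}
    (hx : IsGeneric x) (a : ℕ → F) {lam : Fin l → ℕ} (hlam : IsStrictPartition lam) :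
    facQ x a lam = ∑ mu ∈ strictSub lam, coeffD a lam mu * sympQ x mu := by
  by_cases hl : l ≤ n
  · set c : F := 2 ^ l * (∏ k ∈ range (n - l), (2 * (k + 1 : ℕ) : F))⁻¹ with hc
    have h1 : ∀ mu ∈ strictSub lam, coeffD a lam mu * sympQ x mu =
        c * (coeffD a lam mu * altSum hl x mu) := by
      intro mu hmu
      have hmu' : IsStrictPartition mu := by
        classical
        rw [strictSub, mem_filter] at hmu
        exact hmu.2
      rw [sympQ, facQ_eq hl hx _ hmu', altSum]
      simp only [prod_pad hl]
      simp only [facPow, add_zero, prod_const, card_range]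
      ring
    rw [sum_congr rfl h1, ← mul_sum, ← sum_eq_sum_coeffD a hlam (altSum hl x)
      (altSum_comp_perm hl hx) (fun _ => altSum_eq_zero_of_not_injective hl hx)
      (fun _ => altSum_eq_zero_of_zero hl hx), facQ_eq hl hx a hlam, ← mul_assoc]
    congr 1
    simp only [prod_pad hl, prod_facPow_eq_sum, sum_mul, altSum, mul_sum]
    rw [sum_comm]
    simp only [mul_assoc]
  · simp [facQ, sympQ, hl]

theorem isGeneric_xVar (n : ℕ) : IsGeneric (xVar n) := by
  have hinj := IsFractionRing.injective (MvPolynomial (Fin n ⊕ ℕ) ℚ) (RatField n)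
  have h0 : ∀ i, xVar n i ≠ 0 := fun i h =>
    MvPolynomial.X_ne_zero _ (hinj (by rw [map_zero]; exact h))
  have hX : ∀ i j, xVar n i = xVar n j → i = j := fun i j h =>
    Sum.inl_injective (MvPolynomial.X_injective (hinj h))
  have h1 : ∀ i j, xVar n i * xVar n j ≠ 1 := by
    intro i j h
    have h2 : (MvPolynomial.X (Sum.inl i) * MvPolynomial.X (Sum.inl j) :
        MvPolynomial (Fin n ⊕ ℕ) ℚ) = 1 := hinj (by rw [map_mul, map_one]; exact h)
    simpa using congrArg (MvPolynomial.eval 0) h2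
  refine ⟨h0, ?_⟩
  rintro ⟨i, d⟩ ⟨j, e⟩ h
  rcases Int.units_eq_one_or d with rfl | rfl <;> rcases Int.units_eq_one_or e with rfl | rfl
  · rw [hX i j (by simpa using h)]
  · exact absurd ((mul_eq_one_iff_eq_inv₀ (h0 j)).2 (by simpa using h)) (h1 i j)
  · exact absurd ((mul_eq_one_iff_inv_eq₀ (h0 i)).2 (by simpa using h)) (h1 i j)
  · rw [hX i j (by simpa using h)]

end

end SymplecticQ

theorem mainTheorem7 (n l : ℕ) (lam : Fin l → ℕ) (hlam : SymplecticQ.IsStrictPartition lam) :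
    SymplecticQ.facQ (SymplecticQ.xVar n) (SymplecticQ.aVar n) lam =
      ∑ mu ∈ SymplecticQ.strictSub lam,
        SymplecticQ.coeffD (SymplecticQ.aVar n) lam mu *
          SymplecticQ.sympQ (SymplecticQ.xVar n) mu :=
  SymplecticQ.facQ_eq_sum_coeffD (SymplecticQ.isGeneric_xVar n) _ hlam
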